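/- **Coefficients.** All indices $i_r,\bar i_r,s_r,l_r$ below are positive integers and $\#Q$ is the cardinality of $Q$. Define rational numbers as follows. * $P_{i,j}(s_1,\dots,s_m)=\#\{(i_1,\dots,i_m)\mid i=i_1+\dots+i_m,\ 1\le i_r\le s_r-1\}$. * $T^1_{i,j}(s_1,\dots,s_m)=\sum \frac{1}{k\,n_1!\cdots n_k!}\,P_{i,j}(\sigma_1,\dots,\sigma_k)$, the sum being over all $k\ge1$ and all $n_1,\dots,n_k\ge 1$ with $n_1+\dots+n_k=m$, where $\sigma_r=s_{n_1+\dots+n_{r-1}+1}+\dots+s_{n_1+\dots+n_r}$. * $T^2_{i_1,i_2}\binom{s_1,\dots,s_m}{1,\dots,1}=T^1_{i_1,i_2}(s_1,\dots,s_m)$, and for $k>2$ $$T^2_{i_1,\dots,i_k}\binom{s_1,\dots,s_m}{l_1,\dots,l_m}=\sum_{1\le i\le j\le m,\ s,l\ge1} l\;T^1_{s,i_k}(s_i,\dots,s_j)\;T^2_{i_1,\dots,i_{k-1}}\binom{s_1,\dots,s_{i-1},s,s_{j+1},\dots,s_m}{l_1,\dots,l_{i-1},l,l_{j+1},\dots,l_m},$$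 where $s=s_i+\dots+s_j-i_k$ and $l=(l_i-1)+\dots+(l_j-1)$. * $S_{\bar i_1,\dots,\bar i_{\bar k}}\binom{s_1,\dots,s_m}{l_1,\dots,l_m}=\sum\prod_{r=1}^m\frac{(s_r-1)!}{(s_r-n_r-l_r+1)!\,(l_r-1)!}$, the sum being over all distributions of the $\bar k$ entries $\bar i_1,\dots,\bar i_{\bar k}$ (distinguished by their positions) into $m$ numbered groups such that, for each $r$, the $r$-th group has sum $s_r$ and its number $n_r$ of entries satisfies $s_r-n_r-l_r+1\ge0$. * $N^1_i(i_1,\dots,i_k\,|\,\bar i_1,\dots,\bar i_{\bar k})=0$ if $i\ne i_1+\dots+i_k$ or $i\ne\bar i_1+\dots+\bar i_{\bar k}$. Otherwise it is $\frac{(i-1)!}{(i-\bar k+1)!}$ if $k=1$, it is $\frac{(i-1)!}{(i-k+1)!}$ if $\bar k=1$, and if $k,\bar k>1$ it is $$\sum_{\substack{m\ge1,\ s_r,l_r\ge1\\ s_1+\dots+s_m=i_1+\dots+i_k\\ l_1+\dots+l_m=m+k-2}}(-1)^{m+1}\,S_{\bar i_1,\dots,\bar i_{\bar k}}\binom{s_1,\dots,s_m}{l_1,\dots,l_m}\,T^2_{i_1,\dots,i_k}\binom{s_1,\dots,s_m}{l_1,\dots,l_m}.$$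 * $N^2_i\left(\begin{smallmatrix}i_1,\dots,i_k\\ n_1,\dots,n_k\end{smallmatrix}\middle|\begin{smallmatrix}\bar i_1,\dots,\bar i_{\bar k}\\ \bar n_1,\dots,\bar n_{\bar k}\end{smallmatrix}\right)=N^1_i(i_1,\dots,i_1,\dots,i_k,\dots,i_k\,|\,\bar i_1,\dots,\bar i_1,\dots,\bar i_{\bar k},\dots,\bar i_{\bar k})$, where $i_r$ is repeated $n_r$ times and $\bar i_r$ is repeated $\bar n_r$ times. **The series.** For $\tilde t=(t_0,t_1,\bar t_1,t_2,\bar t_2,\dots)$, with $t_0>0$ real and $t_i,\bar t_i$ ($i\ge1$) complex, $F(\tilde t)$ is the series $$\tfrac12t_0^2\log t_0-\tfrac34t_0^2+\sum\frac{i_1^{n_1}\cdots i_k^{n_k}}{n_1!\cdots n_k!}\,\frac{\bar i_1^{\bar n_1}\cdots\bar i_{\bar k}^{\bar n_{\bar k}}}{\bar n_1!\cdots\bar n_{\bar k}!}\,N^2_i\left(\begin{smallmatrix}i_1,\dots,i_k\\ n_1,\dots,n_k\end{smallmatrix}\middle|\begin{smallmatrix}\bar i_1,\dots,\bar i_{\bar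 k}\\ \bar n_1,\dots,\bar n_{\bar k}\end{smallmatrix}\right)t_0^{\,i-(n_1+\dots+n_k+\bar n_1+\dots+\bar n_{\bar k})+2}\,t_{i_1}^{n_1}\cdots t_{i_k}^{n_k}\,\bar t_{\bar i_1}^{\bar n_1}\cdots\bar t_{\bar i_{\bar k}}^{\bar n_{\bar k}},$$ where the sum is over all integers $i\ge 0$, $k,\bar k\ge1$, $0<i_1<\dots<i_k$, $0<\bar i_1<\dots<\bar i_{\bar k}$ and $n_r,\bar n_r\ge1$ with $i-(n_1+\dots+n_k+\bar n_1+\dots+\bar n_{\bar k})+2\ge0$. **Theorem 3.** Let $n\ge1$, let $0<t_0<1$, and let $t_i,\bar t_i$ ($i\ge1$) be complex numbers (where $\bar t_i$ may be, but need not be, the complex conjugate of $t_i$) such that $t_i=\bar t_i=0$ for $i>n$ and $|t_i|,|\bar t_i|\le(4n^3\,2^n e^n)^{-1}$ for all $i\ge 1$. Then the series $F(\tilde t)$ converges (unconditionally, equivalently absolutely). -/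

import Mathlib

namespace TodaString

/-- `P_{i,j}(s_1, …, s_m)`: the number of tuples `(i_1, …, i_m)` of integers with
`i = i_1 + ⋯ + i_m` and `1 ≤ i_r ≤ s_r - 1` for all `r`.  (The index `j` does not enter.) -/
def P (i _j : ℕ) (s : List ℕ) : ℕ :=
  ((Fintype.piFinset fun r : Fin s.length => Finset.Icc 1 (s.get r - 1)).filter
    fun c => ∑ r, c r = i).card

/-- `T¹_{i,j}(s_1, …, s_m)`: the sum over all `k ≥ 1` and all `n_1 + ⋯ + n_k = m` with `n_r ≥ 1`
of `P_{i,j}(σ_1, …, σ_k) / (k n_1! ⋯ n_k!)`, where `s_1, …, s_m` is cut into consecutive groups of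
lengths `n_1, …, n_k` and `σ_r` is the sum of the entries of the `r`-th group. -/
def T1 (i j : ℕ) (s : List ℕ) : ℚ :=
  ∑ c : Composition s.length,
    1 / ((c.length : ℚ) * (c.blocks.map fun n => (n.factorial : ℚ)).prod) *
      (P i j ((s.splitWrtComposition c).map List.sum) : ℚ)

/-- `T²` with its lower indices listed from the last to the first:
`T2rev [i_k, …, i_1] [(s_1, l_1), …, (s_m, l_m)]` is `T²_{i_1, …, i_k}(s_1 … s_m; l_1 … l_m)`.
For `k = 2` it is `T¹` and is specified only for `l_1 = ⋯ = l_m = 1` (the only case which the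
recursion and the coefficients ever use).  For `k > 2` it is the sum over all blocks of consecutive
pairs, at the (0-based) positions `a ≤ b < m`, which are replaced by the single pair `(s, l)`,
under the condition `s, l ≥ 1`. -/
def T2rev : List ℕ → List (ℕ × ℕ) → ℚ
  | [], _ => 0
  | [_], _ => 0
  | [i₂, i₁], L => if ∀ x ∈ L, x.2 = 1 then T1 i₁ i₂ (L.map Prod.fst) else 0
  | ik :: i₂ :: i₁ :: rest, L =>
      ∑ a ∈ Finset.range L.length, ∑ b ∈ Finset.Ico a L.length,
        let block : List (ℕ × ℕ) := (L.drop a).take (b + 1 - a)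
        let s : ℕ := (block.map Prod.fst).sum - ik
        let l : ℕ := (block.map fun x => x.2 - 1).sum
        if 1 ≤ s ∧ 1 ≤ l then
          (l : ℚ) * T1 s ik (block.map Prod.fst) *
            T2rev (i₂ :: i₁ :: rest) (L.take a ++ (s, l) :: L.drop (b + 1))
        else 0

/-- `T²_{i_1, …, i_k}(s_1 … s_m; l_1 … l_m)`, where `L = [(s_1, l_1), …, (s_m, l_m)]`. -/
def T2 (I : List ℕ) (L : List (ℕ × ℕ)) : ℚ := T2rev I.reverse L

/-- `S_{j_1, …, j_κ}(s_1 … s_m; l_1 … l_m)`: the sum over all distributions `f` of the (labelled)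
entries `j_1, …, j_κ` into `m` groups such that the `r`-th group has sum `s_r` and, `n_r` being its
size, `s_r - n_r - l_r + 1 ≥ 0`, of the product over `r` of
`(s_r - 1)! / ((s_r - n_r - l_r + 1)! (l_r - 1)!)`. -/
def S (J : List ℕ) (L : List (ℕ × ℕ)) : ℚ :=
  ∑ f : Fin J.length → Fin L.length,
    let n : Fin L.length → ℕ := fun r => (Finset.univ.filter fun q => f q = r).card
    if ∀ r, (∑ q ∈ Finset.univ.filter (fun q => f q = r), J.get q) = (L.get r).1 ∧
        n r + (L.get r).2 ≤ (L.get r).1 + 1 then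
      ∏ r, (((L.get r).1 - 1).factorial : ℚ) /
        ((((L.get r).1 + 1 - (n r + (L.get r).2)).factorial : ℚ) *
          (((L.get r).2 - 1).factorial : ℚ))
    else 0

/-- `N¹_i(i_1, …, i_k | j_1, …, j_κ)`.  In the last case `c` runs over the tuples
`(s_1, …, s_m)` of positive integers with sum `i = i_1 + ⋯ + i_k` (for all `m`), and `d` over the
tuples `(l_1, …, l_m)` of positive integers, of the same length `m`, with sum `m + k - 2`. -/
def N1 (i : ℕ) (I J : List ℕ) : ℚ :=
  if i ≠ I.sum ∨ i ≠ J.sum then 0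
  else if I.length = 1 then ((i - 1).factorial : ℚ) / ((i + 1 - J.length).factorial : ℚ)
  else if J.length = 1 then ((i - 1).factorial : ℚ) / ((i + 1 - I.length).factorial : ℚ)
  else
    ∑ c : Composition i, ∑ d : Composition (c.length + I.length - 2),
      if d.length = c.length then
        (-1) ^ (c.length + 1) * S J (c.blocks.zip d.blocks) * T2 I (c.blocks.zip d.blocks)
      else 0

/-- A choice of `0 < i_1 < ⋯ < i_k` and `n_1, …, n_k ≥ 1` is encoded by the finitely supported
function `ν` with `ν i_r = n_r`.  `expand ν` is the list `i_1, …, i_1, …, i_k, …, i_k` in which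
`i_r` is repeated `n_r` times. -/
noncomputable def expand (ν : ℕ+ →₀ ℕ) : List ℕ :=
  ((Finsupp.toMultiset ν).sort (· ≤ ·)).map fun i => (i : ℕ)

/-- `N²_i(i_1 … i_k; n_1 … n_k | j_1 … j_κ; m_1 … m_κ)`. -/
noncomputable def N2 (i : ℕ) (ν μ : ℕ+ →₀ ℕ) : ℚ := N1 i (expand ν) (expand μ)

/-- The indices of the sum in the string series: a number `i` and two nonempty systems of
exponents `ν`, `μ` such that the exponent `i - (∑ n_r + ∑ m_r) + 2` of `t_0` is not negative. -/
structure Index where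
  i : ℕ
  ν : ℕ+ →₀ ℕ
  μ : ℕ+ →₀ ℕ
  ν_ne : ν ≠ 0
  μ_ne : μ ≠ 0
  le : (ν.sum fun _ n => n) + (μ.sum fun _ n => n) ≤ i + 2

/-- The term of the string series with index `x`, at the point with coordinates `t₀`, `t_i = t i`
and `t̄_i = u i`. -/
noncomputable def term (t₀ : ℝ) (t u : ℕ+ → ℂ) (x : Index) : ℂ :=
  (x.ν.prod fun i n => ((i : ℕ) : ℂ) ^ n / (n.factorial : ℂ)) *
    (x.μ.prod fun i n => ((i : ℕ) : ℂ) ^ n / (n.factorial : ℂ)) *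
    (N2 x.i x.ν x.μ : ℂ) *
    (t₀ : ℂ) ^ (x.i + 2 - ((x.ν.sum fun _ n => n) + (x.μ.sum fun _ n => n))) *
    (x.ν.prod fun i n => t i ^ n) * (x.μ.prod fun i n => u i ^ n)

/-- All terms of the string series `F`: the initial term
`(1/2) t_0² log t_0 - (3/4) t_0²` (with index `none`) and the terms of the sum. -/
noncomputable def series (t₀ : ℝ) (t u : ℕ+ → ℂ) : Option Index → ℂ
  | none => ((1 / 2 * t₀ ^ 2 * Real.log t₀ - 3 / 4 * t₀ ^ 2 : ℝ) : ℂ)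
  | some x => term t₀ t u x

end TodaString

namespace TodaString

/-! The coefficients obey |N¹_i| ≤ 6^i · 8^k k! · 8^k̄ k̄! (`abs_N1_le`). The factorials cancel
against the multinomial denominators of the series, and what remains is dominated by a product of
two convergent geometric series (`summable_weight`). The coefficient bound rests on balancing powers
of the s_r. `sum_mul_T1_le` gains a division by the total of the s_r, and this cancels the new entry
s produced by each step of the recursion for T². By induction T² is at most ∏ s_r times (k-2)! and
an exponential factor (`T2rev_le`). Conversely, S remains at most exponential times k̄! after
multiplication by ∏ s_r (`S_mul_prod_le`), so ∏ s_r disappears from S · T². The number of summands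
is exponential as well, because S vanishes for m > k̄. Finally i is the weighted degree of both
systems of exponents, so 6^i ≤ (5/2)^i (5/2)^i can be shared between the t_i and the t̄_i, and 5/2 <
e. -/

/-! ### Bounds for P and T¹. -/

/-- A tuple with prescribed sum is determined by all coordinates but one. The omitted coordinate r₀
can therefore carry an arbitrary value below s_{r₀}, which embeds s_{r₀} copies of the counted set
into a box of size ∏ s_r. Summing over r₀ gives the claim. -/
theorem sum_mul_P_le (i j : ℕ) (s : List ℕ) : s.sum * P i j s ≤ s.length * s.prod := by
  classical
  have key : ∀ r₀ : Fin s.length, s.get r₀ * P i j s ≤ s.prod := by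
    intro r₀
    have hprod : s.prod = (Fintype.piFinset fun r : Fin s.length => Finset.range (s.get r)).card := by
      simp [Fintype.card_piFinset, ← List.prod_ofFn]
    rw [hprod, P, ← Finset.card_range (s.get r₀), ← Finset.card_product]
    refine Finset.card_le_card_of_injOn (fun x => Function.update x.2 r₀ x.1) ?_ ?_
    · intro x hx
      simp only [Finset.coe_product, Set.mem_prod, Finset.mem_coe, Finset.mem_range,
        Finset.mem_filter, Fintype.mem_piFinset, Finset.mem_Icc] at hx ⊢
      intro r
      by_cases h : r = r₀
      · subst h; simpa using hx.1
      · have := hx.2.1 r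
        simp only [Function.update_of_ne h]
        omega
    · intro x hx y hy hxy
      simp only [Finset.coe_product, Set.mem_prod, Finset.mem_coe, Finset.mem_range,
        Finset.mem_filter, Fintype.mem_piFinset, Finset.mem_Icc] at hx hy hxy
      have h1 : x.1 = y.1 := by simpa using congrFun hxy r₀
      have h2 : ∀ r, r ≠ r₀ → x.2 r = y.2 r := fun r hr => by
        simpa [Function.update_of_ne hr] using congrFun hxy r
      have h3 : x.2 r₀ = y.2 r₀ := by
        have hs : ∑ r, x.2 r = ∑ r, y.2 r := hx.2.2.trans hy.2.2.symm
        rw [← Finset.add_sum_erase _ _ (Finset.mem_univ r₀),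
          ← Finset.add_sum_erase _ y.2 (Finset.mem_univ r₀),
          Finset.sum_congr rfl fun r hr => h2 r (Finset.ne_of_mem_erase hr)] at hs
        exact Nat.add_right_cancel hs
      refine Prod.ext h1 (funext fun r => ?_)
      by_cases h : r = r₀
      · rw [h, h3]
      · exact h2 r h
  have hsum : s.sum = ∑ r : Fin s.length, s.get r := by simp [← List.sum_ofFn]
  rw [hsum, Finset.sum_mul]
  calc _ ≤ ∑ _r : Fin s.length, s.prod := Finset.sum_le_sum fun r _ => key r
    _ = _ := by simp

theorem sum_le_length_mul_prod (s : List ℕ) (hs : ∀ x ∈ s, 1 ≤ x) :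
    1 ≤ s.prod ∧ s.sum ≤ s.length * s.prod := by
  induction s with
  | nil => simp
  | cons a s ih =>
    simp only [List.mem_cons, forall_eq_or_imp] at hs
    obtain ⟨h1, h2⟩ := ih hs.2
    refine ⟨by simpa using Nat.mul_le_mul hs.1 h1, ?_⟩
    simp only [List.sum_cons, List.length_cons, List.prod_cons]
    nlinarith [Nat.mul_le_mul_left a h1, Nat.mul_le_mul hs.1 (le_refl (s.length * s.prod))]

/-- In each group the sum is at most its length times its product, and the length is at most its
factorial. These factorials are the denominators n_1! ⋯ n_k! of T¹. -/
theorem prod_map_sum_le (LL : List (List ℕ)) (h : ∀ x ∈ LL.flatten, 1 ≤ x) :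
    (LL.map List.sum).prod ≤ ((LL.map List.length).map Nat.factorial).prod * LL.flatten.prod := by
  induction LL with
  | nil => simp
  | cons s LL ih =>
    simp only [List.flatten_cons, List.mem_append] at h
    have h1 := (sum_le_length_mul_prod s fun x hx => h x (Or.inl hx)).2
    have h2 := ih fun x hx => h x (Or.inr hx)
    simp only [List.map_cons, List.prod_cons, List.flatten_cons, List.prod_append]
    calc _ ≤ (s.length * s.prod) * _ := Nat.mul_le_mul h1 h2
      _ ≤ (s.length.factorial * s.prod) * _ :=
        Nat.mul_le_mul_right _ (Nat.mul_le_mul_right _ s.length.self_le_factorial)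
      _ = _ := by ring

theorem T1_nonneg (i j : ℕ) (s : List ℕ) : 0 ≤ T1 i j s := by
  refine Finset.sum_nonneg fun c _ => mul_nonneg (one_div_nonneg.2 (mul_nonneg (by positivity)
    (List.prod_nonneg ?_))) (by positivity)
  simp

/-- Every composition contributes at most ∏ s_r: the factor k from the bound for P and the
factorials from grouping cancel the denominator. There are 2^(m-1) compositions. -/
theorem sum_mul_T1_le (i j : ℕ) (s : List ℕ) (hs : ∀ x ∈ s, 1 ≤ x) :
    (s.sum : ℚ) * T1 i j s ≤ 2 ^ (s.length - 1) * (s.prod : ℚ) := by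
  have key : ∀ c : Composition s.length,
      (s.sum : ℚ) * (1 / ((c.length : ℚ) * (c.blocks.map fun n => (n.factorial : ℚ)).prod) *
      (P i j ((s.splitWrtComposition c).map List.sum) : ℚ)) ≤ s.prod := by
    intro c
    have hfl : (s.splitWrtComposition c).flatten = s := List.flatten_splitWrtComposition s c
    have hlen : (s.splitWrtComposition c).map List.length = c.blocks :=
      List.map_length_splitWrtComposition s c
    have h1 := sum_mul_P_le i j ((s.splitWrtComposition c).map List.sum)
    have h2 := prod_map_sum_le (s.splitWrtComposition c) (by rwa [hfl])
    rw [← List.sum_flatten, hfl] at h1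
    rw [hfl, hlen] at h2
    have h3 : ((s.splitWrtComposition c).map List.sum).length = c.length := by simp
    rw [h3] at h1
    have h4 : (c.blocks.map fun n => (n.factorial : ℚ)).prod
        = (((c.blocks.map Nat.factorial).prod : ℕ) : ℚ) := by
      rw [Nat.cast_list_prod, List.map_map]; rfl
    have h5 : 0 < (c.blocks.map Nat.factorial).prod := by
      refine List.prod_pos ?_
      simp [Nat.factorial_pos]
    rw [h4]
    rcases Nat.eq_zero_or_pos c.length with h0 | h0
    · rw [h0, Nat.cast_zero, zero_mul, div_zero, zero_mul, mul_zero]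
      exact Nat.cast_nonneg _
    have h6 : s.sum * P i j ((s.splitWrtComposition c).map List.sum) ≤
        (c.length * (c.blocks.map Nat.factorial).prod) * s.prod :=
      h1.trans (by rw [mul_assoc]; exact Nat.mul_le_mul_left _ h2)
    have h7 : (0 : ℚ) < (c.length : ℚ) * ((c.blocks.map Nat.factorial).prod : ℕ) := by
      exact_mod_cast Nat.mul_pos h0 h5
    rw [mul_left_comm, one_div, inv_mul_le_iff₀ h7]
    exact_mod_cast h6
  rw [T1, Finset.mul_sum]
  calc _ ≤ ∑ _c : Composition s.length, (s.prod : ℚ) := Finset.sum_le_sum fun c _ => key c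
    _ = _ := by simp [composition_card]

/-! ### The bound for T². -/

theorem T2rev_nonneg : ∀ (R : List ℕ) (L : List (ℕ × ℕ)), 0 ≤ T2rev R L
  | [], _ => by simp [T2rev]
  | [_], _ => by simp [T2rev]
  | [i₂, i₁], L => by
    rw [T2rev]; split_ifs
    · exact T1_nonneg _ _ _
    · exact le_rfl
  | ik :: i₂ :: i₁ :: rest, L => by
    rw [T2rev]
    refine Finset.sum_nonneg fun a _ => Finset.sum_nonneg fun b _ => ?_
    dsimp only
    split_ifs
    · exact mul_nonneg (mul_nonneg (by positivity) (T1_nonneg _ _ _)) (T2rev_nonneg _ _)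
    · exact le_rfl

theorem sum_half_pow_le (m : ℕ) : ∑ k ∈ Finset.range m, (1 / 2 : ℚ) ^ (k + 1) ≤ 1 := by
  have h : ∑ k ∈ Finset.range m, (1 / 2 : ℚ) ^ (k + 1) = 1 - (1 / 2) ^ m := by
    induction m with
    | zero => simp
    | succ m ih => rw [Finset.sum_range_succ, ih]; ring
  rw [h]
  linarith [show (0 : ℚ) ≤ (1 / 2) ^ m by positivity]

/-- Blocks `[a, b]` weighted by `2 ^ (-length)`: each point lies in blocks of total weight `≤ 2`. -/
theorem sum_blocks_le (m : ℕ) (e : ℕ → ℚ) (he : ∀ p, 0 ≤ e p) :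
    ∑ a ∈ Finset.range m, ∑ b ∈ Finset.Ico a m,
      (∑ p ∈ Finset.Ico a (b + 1), e p) * (1 / 2) ^ (b + 1 - a) ≤
      2 * ∑ p ∈ Finset.range m, e p := by
  have h1 : ∀ a ∈ Finset.range m, ∀ b ∈ Finset.Ico a m,
      (∑ p ∈ Finset.Ico a (b + 1), e p) * (1 / 2 : ℚ) ^ (b + 1 - a) =
      ∑ p ∈ Finset.range m, if a ≤ p ∧ p ≤ b then
        2 * e p * ((1 / 2) ^ (p - a + 1) * (1 / 2) ^ (b - p + 1)) else 0 := by
    intro a ha b hb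
    rw [Finset.mem_range] at ha
    rw [Finset.mem_Ico] at hb
    rw [← Finset.sum_filter, Finset.sum_mul]
    have : (Finset.range m).filter (fun p => a ≤ p ∧ p ≤ b) = Finset.Ico a (b + 1) := by
      ext p; simp only [Finset.mem_filter, Finset.mem_range, Finset.mem_Ico]; omega
    rw [this]
    refine Finset.sum_congr rfl fun p hp => ?_
    rw [Finset.mem_Ico] at hp
    -- The weight splits at p into a left and a right part; p is counted on both sides, whence the
    -- extra factor 2.
    rw [← pow_add, show p - a + 1 + (b - p + 1) = (b + 1 - a) + 1 by omega, pow_succ]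
    ring
  rw [Finset.sum_congr rfl fun a ha => Finset.sum_congr rfl fun b hb => h1 a ha b hb]
  rw [Finset.sum_congr rfl fun a _ => Finset.sum_comm, Finset.sum_comm, Finset.mul_sum]
  refine Finset.sum_le_sum fun p hp => ?_
  rw [Finset.mem_range] at hp
  calc _ ≤ ∑ a ∈ Finset.range (p + 1), ∑ b ∈ Finset.Ico p m,
        2 * e p * ((1 / 2 : ℚ) ^ (p - a + 1) * (1 / 2) ^ (b - p + 1)) := by
        have : Finset.range (p + 1) = (Finset.range m).filter fun a => a ≤ p := by
          ext a; simp only [Finset.mem_filter, Finset.mem_range]; omega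
        rw [this, Finset.sum_filter]
        refine Finset.sum_le_sum fun a ha => ?_
        split_ifs with h
        · rw [← Finset.sum_filter]
          refine Finset.sum_le_sum_of_subset_of_nonneg ?_ ?_
          · intro b; simp only [Finset.mem_filter, Finset.mem_Ico]; omega
          · intro b _ _
            have := he p
            positivity
        · refine (Finset.sum_eq_zero fun b _ => ?_).le
          rw [if_neg (by tauto)]
    _ = 2 * e p * ((∑ k ∈ Finset.range (p + 1), (1 / 2 : ℚ) ^ (k + 1)) *
          ∑ k ∈ Finset.range (m - p), (1 / 2 : ℚ) ^ (k + 1)) := by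
        rw [← Finset.sum_range_reflect, Finset.sum_mul_sum, Finset.mul_sum]
        refine Finset.sum_congr rfl fun a ha => ?_
        rw [Finset.sum_Ico_eq_sum_range, Finset.mul_sum]
        refine Finset.sum_congr rfl fun b hb => ?_
        rw [Finset.mem_range] at ha
        rw [show p - (p + 1 - 1 - a) + 1 = a + 1 by omega, show p + b - p + 1 = b + 1 by omega]
    _ ≤ 2 * e p * (1 * 1) := by
        have := he p
        refine mul_le_mul_of_nonneg_left ?_ (by positivity)
        exact mul_le_mul (sum_half_pow_le _) (sum_half_pow_le _)
          (Finset.sum_nonneg fun _ _ => by positivity) zero_le_one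
    _ = _ := by ring

theorem sum_take_drop (e : List ℕ) (a k : ℕ) :
    ((e.drop a).take k).sum = ∑ p ∈ Finset.Ico a (a + k), e.getD p 0 := by
  induction k with
  | zero => simp
  | succ k ih =>
    rw [← add_assoc, Finset.sum_Ico_succ_top (by omega), ← ih, List.take_add_one, List.sum_append]
    congr 1
    rw [List.getElem?_drop, List.getD_eq_getElem?_getD]
    cases e[a + k]? <;> simp

theorem prod_take_block_drop (s : List ℕ) (a k : ℕ) :
    (s.take a).prod * ((s.drop a).take k).prod * (s.drop (a + k)).prod = s.prod := by
  rw [mul_assoc, ← List.drop_drop, List.prod_take_mul_prod_drop, List.prod_take_mul_prod_drop]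

theorem sum_take_block_drop (s : List ℕ) (a k : ℕ) :
    (s.take a).sum + ((s.drop a).take k).sum + (s.drop (a + k)).sum = s.sum := by
  rw [add_assoc, ← List.drop_drop, List.sum_take_add_sum_drop, List.sum_take_add_sum_drop]

theorem T1_nil (i j : ℕ) : T1 i j [] = 0 := by
  refine Finset.sum_eq_zero fun c _ => ?_
  have h : c.length = 0 := Nat.le_zero.1 c.length_le
  rw [h, Nat.cast_zero, zero_mul, div_zero, zero_mul]

/-- Induction on N = ∑ (l_r - 1). Merging a block lowers this sum by exactly one, since the new l is
the block's share of it. The new s in the inductive bound is absorbed by T¹, and the factors l,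
weighted by 2^(-block length), add up to at most 2(N + 1), which turns N! into (N + 1)!. -/
theorem T2rev_le : ∀ (N : ℕ) (R : List ℕ) (L : List (ℕ × ℕ)), R.length = N + 2 →
    (∀ x ∈ L, 1 ≤ x.1) → (L.map fun x => x.2 - 1).sum = N →
    T2rev R L ≤ ((L.map Prod.fst).prod : ℚ) * (N.factorial * 4 ^ (N + L.length))
  | 0, [i₂, i₁], L, _, hs, hl => by
    have hs' : ∀ x ∈ L.map Prod.fst, 1 ≤ x := by simpa using fun a b h => hs (a, b) h
    have hT := sum_mul_T1_le i₁ i₂ (L.map Prod.fst) hs'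
    have h0 := T1_nonneg i₁ i₂ (L.map Prod.fst)
    rw [T2rev]
    have hT' : T1 i₁ i₂ (L.map Prod.fst) ≤ ((L.map Prod.fst).prod : ℕ) * 4 ^ L.length := by
      rcases L with _ | ⟨x, L⟩
      · rw [List.map_nil, T1_nil]; positivity
      have h1 : (1 : ℚ) ≤ (((x :: L).map Prod.fst).sum : ℕ) := by
        have := hs x (by simp)
        rw [List.map_cons, List.sum_cons]
        exact_mod_cast le_add_right this
      have h2 : (2 : ℚ) ^ (((x :: L).map Prod.fst).length - 1) ≤ 4 ^ (x :: L).length := by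
        calc (2 : ℚ) ^ (((x :: L).map Prod.fst).length - 1) ≤ 2 ^ (x :: L).length := by
              refine pow_le_pow_right₀ (by norm_num) ?_
              simp
          _ ≤ _ := pow_le_pow_left₀ (by norm_num) (by norm_num) _
      calc _ ≤ _ * T1 i₁ i₂ ((x :: L).map Prod.fst) := le_mul_of_one_le_left h0 h1
        _ ≤ _ := hT
        _ ≤ _ := by rw [mul_comm]; exact mul_le_mul_of_nonneg_left h2 (Nat.cast_nonneg _)
    split_ifs
    · simpa using hT'
    · positivity
  | N + 1, ik :: i₂ :: i₁ :: rest, L, hR, hs, hl => by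
    have hR' : (i₂ :: i₁ :: rest).length = N + 2 := by simpa using hR
    rw [T2rev]
    set m := L.length with hm
    set e : ℕ → ℕ := fun p => (L.map fun x => x.2 - 1).getD p 0 with he
    have hterm : ∀ a ∈ Finset.range m, ∀ b ∈ Finset.Ico a m,
        (let block : List (ℕ × ℕ) := (L.drop a).take (b + 1 - a)
        let s : ℕ := (block.map Prod.fst).sum - ik
        let l : ℕ := (block.map fun x => x.2 - 1).sum
        if 1 ≤ s ∧ 1 ≤ l then
          (l : ℚ) * T1 s ik (block.map Prod.fst) *
            T2rev (i₂ :: i₁ :: rest) (L.take a ++ (s, l) :: L.drop (b + 1))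
        else 0) ≤
        -- The division by 2 anticipates the factor 2 of `sum_blocks_le`.
        (((L.map Prod.fst).prod : ℚ) * (N.factorial * 4 ^ (N + 1 + m)) / 2) *
          ((∑ p ∈ Finset.Ico a (b + 1), (e p : ℚ)) * (1 / 2) ^ (b + 1 - a)) := by
      intro a ha b hb
      rw [Finset.mem_range] at ha
      rw [Finset.mem_Ico] at hb
      obtain ⟨k, rfl⟩ : ∃ k, b = a + k := ⟨b - a, by omega⟩
      rw [show a + k + 1 - a = k + 1 by omega, add_assoc a k 1]
      extract_lets block s l
      have hl' : l = ∑ p ∈ Finset.Ico a (a + (k + 1)), e p := by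
        rw [← sum_take_drop, ← List.map_drop, ← List.map_take]
      rw [← Nat.cast_sum, ← hl']
      split_ifs with hsl
      swap
      · positivity
      have hblock : ∀ x ∈ block.map Prod.fst, 1 ≤ x := by
        intro x hx
        obtain ⟨y, hy, rfl⟩ := List.mem_map.1 hx
        exact hs y (List.mem_of_mem_drop (List.mem_of_mem_take hy))
      have hlen : block.length = k + 1 := by
        simp only [block, List.length_take, List.length_drop]
        omega
      set L' := L.take a ++ (s, l) :: L.drop (a + (k + 1)) with hL'
      have hlen' : L'.length + k = m := by
        simp only [hL', List.length_append, List.length_cons, List.length_take, List.length_drop]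
        omega
      have hs' : ∀ x ∈ L', 1 ≤ x.1 := by
        intro x hx
        simp only [hL', List.mem_append, List.mem_cons] at hx
        rcases hx with h | h | h
        · exact hs x (List.mem_of_mem_take h)
        · rw [h]; exact hsl.1
        · exact hs x (List.mem_of_mem_drop h)
      have hl'' : (L'.map fun x => x.2 - 1).sum = N := by
        have := sum_take_block_drop (L.map fun x => x.2 - 1) a (k + 1)
        rw [hl, ← List.map_drop, ← List.map_take, ← List.map_take, ← List.map_drop] at this
        simp only [hL', List.map_append, List.map_cons, List.sum_append, List.sum_cons]
        have h2 : l =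
            (List.map (fun x : ℕ × ℕ => x.2 - 1) (List.take (k + 1) (List.drop a L))).sum := rfl
        have := hsl.2
        omega
      have ih := T2rev_le N (i₂ :: i₁ :: rest) L' hR' hs' hl''
      have hT := sum_mul_T1_le s ik (block.map Prod.fst) hblock
      have hT0 := T1_nonneg s ik (block.map Prod.fst)
      have hP : (L'.map Prod.fst).prod =
          s * (((L.take a).map Prod.fst).prod * ((L.drop (a + (k + 1))).map Prod.fst).prod) := by
        simp only [hL', List.map_append, List.map_cons, List.prod_append, List.prod_cons]
        ring
      have hQ : (block.map Prod.fst).prod *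
          (((L.take a).map Prod.fst).prod * ((L.drop (a + (k + 1))).map Prod.fst).prod) =
          (L.map Prod.fst).prod := by
        rw [← prod_take_block_drop (L.map Prod.fst) a (k + 1), ← List.map_drop, ← List.map_take,
          ← List.map_take, ← List.map_drop]
        ring
      set Q := ((L.take a).map Prod.fst).prod * ((L.drop (a + (k + 1))).map Prod.fst).prod
      -- Only s ≤ sum of the block is needed, and it holds for truncated subtraction.
      have hsT : (s : ℚ) * T1 s ik (block.map Prod.fst) ≤ 2 ^ k * ((block.map Prod.fst).prod : ℕ) := by
        rw [List.length_map, hlen, Nat.add_sub_cancel] at hT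
        refine le_trans (mul_le_mul_of_nonneg_right ?_ hT0) hT
        exact_mod_cast Nat.sub_le _ _
      calc (l : ℚ) * T1 s ik (block.map Prod.fst) * T2rev (i₂ :: i₁ :: rest) L'
          ≤ l * T1 s ik (block.map Prod.fst) *
            ((L'.map Prod.fst).prod * (N.factorial * 4 ^ (N + L'.length))) :=
            mul_le_mul_of_nonneg_left ih (by positivity)
        _ = (s * T1 s ik (block.map Prod.fst)) *
            (l * (Q * (N.factorial * 4 ^ (N + L'.length)))) := by
            rw [hP]; push_cast; ring
        _ ≤ (2 ^ k * ((block.map Prod.fst).prod : ℕ)) *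
            (l * (Q * (N.factorial * 4 ^ (N + L'.length)))) :=
            mul_le_mul_of_nonneg_right hsT (by positivity)
        _ = _ := by
            rw [← hQ, ← hlen']
            -- The merged list is shorter by k. Of the 4^k gained, one 2^k pays for T¹ and the other
            -- for the block weight; the single 4 cancels the two remaining halves.
            have : (4 : ℚ) ^ (N + 1 + (L'.length + k)) = 4 ^ (N + L'.length) * 4 * (2 ^ k * 2 ^ k) := by
              rw [← mul_pow]; norm_num; ring
            rw [this, pow_succ]
            have h2 : (2 : ℚ) ^ k * (1 / 2) ^ k = 1 := by rw [← mul_pow]; norm_num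
            rw [Nat.cast_mul (block.map Prod.fst).prod Q]
            linear_combination (-(2 ^ k * ((block.map Prod.fst).prod : ℕ) *
              (l * (Q * (N.factorial * 4 ^ (N + L'.length)))))) * h2
    refine (Finset.sum_le_sum fun a ha => Finset.sum_le_sum fun b hb => hterm a ha b hb).trans ?_
    simp_rw [← Finset.mul_sum]
    have hsum : ∑ p ∈ Finset.range m, (e p : ℚ) = N + 1 := by
      have := sum_take_drop (L.map fun x => x.2 - 1) 0 m
      rw [List.drop_zero, List.take_of_length_le (by simp [hm]), hl, zero_add,
        ← Finset.range_eq_Ico] at this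
      rw [← Nat.cast_sum, ← this]
      push_cast; rfl
    calc _ ≤ (((L.map Prod.fst).prod : ℚ) * (N.factorial * 4 ^ (N + 1 + m)) / 2) *
          (2 * ∑ p ∈ Finset.range m, (e p : ℚ)) :=
          mul_le_mul_of_nonneg_left (sum_blocks_le m _ fun p => Nat.cast_nonneg _) (by positivity)
      _ = _ := by
        rw [hsum, Nat.factorial_succ]; push_cast; ring
  | 0, [], L, h, _, _ => by simp at h
  | 0, [_], L, h, _, _ => by simp at h
  | 0, _ :: _ :: _ :: _, L, h, _, _ => by simp at h
  | N + 1, [], L, h, _, _ => by simp at h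
  | N + 1, [_], L, h, _, _ => by simp at h
  | N + 1, [_, _], L, h, _, _ => by simp at h

/-! ### The bound for S. -/

/-- If h₂ q < h₁ q, compare the total of J over the groups up to h₂ q. By monotonicity h₁ places
there only entries before q, while h₂ places there all of these and q too; as J q is positive, the
totals cannot agree. -/
theorem monotone_le_of_fiber_sum_eq {k m : ℕ} {h₁ h₂ : Fin k → Fin m} (m₁ : Monotone h₁)
    (m₂ : Monotone h₂) (J : Fin k → ℕ) (hJ : ∀ q, 1 ≤ J q)
    (h : ∀ r, (∑ q, if h₁ q = r then J q else 0) = ∑ q, if h₂ q = r then J q else 0) (q : Fin k) :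
    h₁ q ≤ h₂ q := by
  by_contra! hq
  have hsum : ∀ g : Fin k → Fin m, (∑ p, if g p ≤ h₂ q then J p else 0) =
      ∑ r ∈ Finset.Iic (h₂ q), ∑ p, if g p = r then J p else 0 := by
    intro g
    rw [Finset.sum_comm]
    refine Finset.sum_congr rfl fun p _ => ?_
    rw [Finset.sum_ite_eq]
    simp
  have heq := (hsum h₁).trans ((Finset.sum_congr rfl fun r _ => h r).trans (hsum h₂).symm)
  refine heq.not_lt (Finset.sum_lt_sum (fun p _ => ?_) ⟨q, Finset.mem_univ _, ?_⟩)
  · by_cases hp : h₁ p ≤ h₂ q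
    · have hpq : p ≤ q := by
        by_contra! hlt
        exact absurd (hp.trans_lt hq) (m₁ hlt.le).not_gt
      simp [hp, m₂ hpq]
    · simp [hp]
  · simp only [hq.not_ge, if_false, le_refl, if_true]
    exact hJ q

/-- Each distribution of labelled positive entries with prescribed group sums, together with an
ordering of every group, comes from at most one ordering of all the entries. -/
theorem sum_prod_factorial_fiber_le {k m : ℕ} (J : Fin k → ℕ) (hJ : ∀ q, 1 ≤ J q)
    (s : Fin m → ℕ) :
    ∑ f : Fin k → Fin m, (if ∀ r, (∑ q ∈ Finset.univ.filter (fun q => f q = r), J q) = s r then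
      ∏ r, ((Finset.univ.filter fun q => f q = r).card).factorial else 0) ≤ k.factorial := by
  classical
  rw [← Finset.sum_filter]
  -- The product of factorials is the order of the stabilizer of f, so the whole sum counts pairs
  -- (f, g) with g preserving f.
  have hcard : ∀ f : Fin k → Fin m,
      (∏ r, ((Finset.univ.filter fun q => f q = r).card).factorial) =
      (Finset.univ.filter fun g : Equiv.Perm (Fin k) => f ∘ g = f).card := by
    intro f
    rw [← Fintype.card_subtype, DomMulAct.stabilizer_card]
    simp_rw [Fintype.card_subtype]
  simp_rw [hcard]
  rw [← Finset.card_sigma]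
  have hperm : k.factorial = (Finset.univ : Finset (Equiv.Perm (Fin k))).card := by
    rw [Finset.card_univ, Fintype.card_perm, Fintype.card_fin]
  rw [hperm]
  -- The permutation lists the entries group by group. Along it f becomes monotone, and the group
  -- sums then determine f, hence also g.
  refine Finset.card_le_card_of_injOn (fun x => x.2 * Tuple.sort x.1) (fun _ _ => by simp) ?_
  have hcomp : ∀ (f : Fin k → Fin m) (g : Equiv.Perm (Fin k)), f ∘ g = f →
      f ∘ (g * Tuple.sort f : Equiv.Perm (Fin k)) = f ∘ Tuple.sort f := by
    intro f g hg
    rw [Equiv.Perm.coe_mul, ← Function.comp_assoc, hg]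
  rintro ⟨f₁, g₁⟩ h₁ ⟨f₂, g₂⟩ h₂ heq
  simp only [Finset.coe_sigma, Set.mem_sigma_iff, Finset.mem_coe, Finset.mem_filter,
    Finset.mem_univ, true_and] at h₁ h₂ heq
  set w := g₁ * Tuple.sort f₁ with hw
  have hsum : ∀ f : Fin k → Fin m,
      (∀ r, (∑ q ∈ Finset.univ.filter (fun q => f q = r), J q) = s r) →
      ∀ r, (∑ q, if (f ∘ w) q = r then J (w q) else 0) = s r := by
    intro f hf r
    rw [← hf r, Finset.sum_filter]
    exact Equiv.sum_comp w fun q => if f q = r then J q else 0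
  have mono₁ : Monotone (f₁ ∘ w) := by
    rw [hw, hcomp f₁ g₁ h₁.2]; exact Tuple.monotone_sort f₁
  have mono₂ : Monotone (f₂ ∘ w) := by
    rw [heq, hcomp f₂ g₂ h₂.2]; exact Tuple.monotone_sort f₂
  have hs : ∀ r, (∑ q, if (f₁ ∘ w) q = r then J (w q) else 0) =
      ∑ q, if (f₂ ∘ w) q = r then J (w q) else 0 := fun r =>
    (hsum f₁ h₁.1 r).trans (hsum f₂ h₂.1 r).symm
  have hfw : f₁ ∘ w = f₂ ∘ w := funext fun q => le_antisymm
    (monotone_le_of_fiber_sum_eq mono₁ mono₂ (J ∘ w) (fun q => hJ _) hs q)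
    (monotone_le_of_fiber_sum_eq mono₂ mono₁ (J ∘ w) (fun q => hJ _) (fun r => (hs r).symm) q)
  have hf : f₁ = f₂ := w.surjective.injective_comp_right hfw
  subst hf
  rw [mul_right_cancel (hw.symm.trans heq)]

/-- After division by n! the left side is the trinomial coefficient of s with parts n, l - 1 and s -
n - l + 1. -/
theorem factorial_ratio_le {s l n : ℕ} (hs : 1 ≤ s) (hl : 1 ≤ l) (h : n + l ≤ s + 1) :
    (s : ℚ) * (((s - 1).factorial : ℚ) /
      (((s + 1 - (n + l)).factorial : ℚ) * ((l - 1).factorial : ℚ))) ≤ 3 ^ s * n.factorial := by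
  obtain ⟨l, rfl⟩ := Nat.exists_eq_add_of_le' hl
  obtain ⟨s, rfl⟩ := Nat.exists_eq_add_of_le' hs
  rw [Nat.add_sub_cancel, Nat.add_sub_cancel, show s + 1 + 1 - (n + (l + 1)) = s + 1 - n - l by omega,
    mul_div_assoc', div_le_iff₀ (by positivity)]
  have h1 := Nat.choose_mul_factorial_mul_factorial (show n ≤ s + 1 by omega)
  have h2 := Nat.choose_mul_factorial_mul_factorial (show l ≤ s + 1 - n by omega)
  have h3 : (s + 1).choose n * (s + 1 - n).choose l ≤ 3 ^ (s + 1) := by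
    calc _ ≤ (s + 1).choose n * 2 ^ (s + 1 - n) :=
          Nat.mul_le_mul_left _ (Nat.choose_le_two_pow _ _)
      -- A single term of the binomial expansion of (1 + 2)^(s + 1).
      _ ≤ ∑ p ∈ Finset.range (s + 1 + 1), 1 ^ p * 2 ^ (s + 1 - p) * (s + 1).choose p := by
          refine le_trans (le_of_eq ?_) (Finset.single_le_sum
            (f := fun p => 1 ^ p * 2 ^ (s + 1 - p) * (s + 1).choose p) (fun _ _ => Nat.zero_le _)
            (Finset.mem_range.2 (show n < s + 1 + 1 by omega)))
          simp [mul_comm]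
      _ = _ := (add_pow (1 : ℕ) 2 (s + 1)).symm
  rw [← h2] at h1
  have h4 : (s + 1) * s.factorial ≤
      3 ^ (s + 1) * n.factorial * ((s + 1 - n - l).factorial * l.factorial) := by
    rw [← Nat.factorial_succ, ← h1]
    calc _ = ((s + 1).choose n * (s + 1 - n).choose l) *
          (n.factorial * ((s + 1 - n - l).factorial * l.factorial)) := by ring
      _ ≤ _ := Nat.mul_le_mul_right _ h3
      _ = _ := by ring
  exact_mod_cast h4

theorem S_nonneg (J : List ℕ) (L : List (ℕ × ℕ)) : 0 ≤ S J L := by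
  refine Finset.sum_nonneg fun f _ => ?_
  dsimp only
  split_ifs
  · positivity
  · exact le_rfl

theorem S_mul_prod_le (J : List ℕ) (L : List (ℕ × ℕ)) (hJ : ∀ x ∈ J, 1 ≤ x)
    (hL : ∀ x ∈ L, 1 ≤ x.1 ∧ 1 ≤ x.2) :
    ((L.map Prod.fst).prod : ℚ) * S J L ≤ 3 ^ (L.map Prod.fst).sum * J.length.factorial := by
  have hprod : (L.map Prod.fst).prod = ∏ r : Fin L.length, (L.get r).1 := by
    rw [← List.prod_ofFn]; congr 1; simp [List.ofFn_getElem_eq_map]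
  have hsum : (L.map Prod.fst).sum = ∑ r : Fin L.length, (L.get r).1 := by
    rw [← List.sum_ofFn]; congr 1; simp [List.ofFn_getElem_eq_map]
  have key := sum_prod_factorial_fiber_le J.get (fun q => hJ _ (List.get_mem _ _))
    fun r : Fin L.length => (L.get r).1
  calc _ ≤ (3 : ℚ) ^ (L.map Prod.fst).sum * (∑ f : Fin J.length → Fin L.length,
        (if ∀ r, (∑ q ∈ Finset.univ.filter (fun q => f q = r), J.get q) = (L.get r).1 then
          ∏ r, ((Finset.univ.filter fun q => f q = r).card).factorial else 0) : ℕ) := by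
        rw [S, Finset.mul_sum, Nat.cast_sum, Finset.mul_sum]
        refine Finset.sum_le_sum fun f _ => ?_
        dsimp only
        split_ifs with h1 h2 h2
        · rw [hprod, hsum, ← Finset.prod_pow_eq_pow_sum, Nat.cast_prod, Nat.cast_prod,
            ← Finset.prod_mul_distrib, ← Finset.prod_mul_distrib]
          refine Finset.prod_le_prod (fun r _ => by positivity) fun r _ => ?_
          have := hL _ (List.get_mem L r)
          exact factorial_ratio_le this.1 this.2 (h1 r).2
        · exact absurd (fun r => (h1 r).1) h2
        · rw [mul_zero]; positivity
        · simp
    _ ≤ _ := mul_le_mul_of_nonneg_left (by exact_mod_cast key) (by positivity)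

/-- An empty group cannot have a positive sum. This caps m by k̄ in N¹, so factors exponential in m
become exponential in k̄. -/
theorem S_eq_zero_of_length_lt (J : List ℕ) (L : List (ℕ × ℕ)) (hL : ∀ x ∈ L, 1 ≤ x.1)
    (h : J.length < L.length) : S J L = 0 := by
  refine Finset.sum_eq_zero fun f _ => ?_
  refine if_neg fun hf => ?_
  have hsurj : Function.Surjective f := by
    intro r
    by_contra! hr
    have h1 := (hf r).1
    rw [Finset.filter_false_of_mem (fun q _ => hr q), Finset.sum_empty] at h1
    exact absurd (hL _ (List.get_mem L r)) (by omega)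
  have := Fintype.card_le_of_surjective f hsurj
  simp at this
  omega

/-! ### The bound for N¹. -/

theorem length_le_sum (s : List ℕ) (hs : ∀ x ∈ s, 1 ≤ x) : s.length ≤ s.sum := by
  simpa using List.card_nsmul_le_sum s 1 hs

theorem factorial_div_le {i k : ℕ} (hk : k ≤ i) :
    ((i - 1).factorial : ℚ) / ((i + 1 - k).factorial : ℚ) ≤ 2 ^ i * k.factorial := by
  rw [div_le_iff₀ (by positivity)]
  have h1 := Nat.choose_mul_factorial_mul_factorial hk
  have h2 : (i - 1).factorial ≤ 2 ^ i * k.factorial * (i + 1 - k).factorial := by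
    calc (i - 1).factorial ≤ i.factorial := Nat.factorial_le (Nat.sub_le _ _)
      _ = i.choose k * k.factorial * (i - k).factorial := h1.symm
      _ ≤ _ := Nat.mul_le_mul (Nat.mul_le_mul_right _ (Nat.choose_le_two_pow _ _))
        (Nat.factorial_le (by omega))
  exact_mod_cast h2

theorem abs_S_mul_T2_le {i N : ℕ} {I J : List ℕ} (hJ : ∀ x ∈ J, 1 ≤ x) (hI : I.length = N + 2)
    (c : Composition i) (d : Composition (c.length + N)) (h : d.length = c.length) :
    |(-1) ^ (c.length + 1) * S J (c.blocks.zip d.blocks) * T2 I (c.blocks.zip d.blocks)| ≤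
      3 ^ i * 4 ^ (N + c.length) * (J.length.factorial * N.factorial) := by
  set L := c.blocks.zip d.blocks with hL
  have hlen : c.blocks.length = d.blocks.length := h.symm
  have hfst : L.map Prod.fst = c.blocks := List.map_fst_zip hlen.le
  have hsnd : L.map Prod.snd = d.blocks := List.map_snd_zip hlen.ge
  have hpos : ∀ x ∈ L, 1 ≤ x.1 ∧ 1 ≤ x.2 := fun x hx =>
    ⟨c.one_le_blocks (hfst ▸ List.mem_map_of_mem hx),
      d.one_le_blocks (hsnd ▸ List.mem_map_of_mem hx)⟩
  have hLlen : L.length = c.length := by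
    rw [← List.length_map (f := Prod.fst), hfst, Composition.blocks_length]
  have hl : (L.map fun x => x.2 - 1).sum = N := by
    have h1 : ∀ M : List (ℕ × ℕ), (∀ x ∈ M, 1 ≤ x.1 ∧ 1 ≤ x.2) →
        (M.map fun x => x.2 - 1).sum + M.length = (M.map Prod.snd).sum := by
      intro M hM
      induction M with
      | nil => rfl
      | cons x M ih =>
        simp only [List.mem_cons, forall_eq_or_imp] at hM
        have := ih hM.2
        simp only [List.map_cons, List.sum_cons, List.length_cons]
        omega
    have h2 := h1 L hpos
    rw [hsnd, d.blocks_sum, hLlen] at h2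
    omega
  have hS := S_mul_prod_le J L hJ hpos
  have hT := T2rev_le N I.reverse L (by rw [List.length_reverse, hI]) (fun x hx => (hpos x hx).1) hl
  rw [hfst, c.blocks_sum] at hS
  rw [hfst, hLlen] at hT
  have hS0 := S_nonneg J L
  have hT0 : 0 ≤ T2 I L := T2rev_nonneg _ _
  rw [abs_mul, abs_mul, abs_pow, abs_neg, abs_one, one_pow, one_mul, abs_of_nonneg hS0,
    abs_of_nonneg hT0]
  calc S J L * T2 I L ≤ S J L * _ := mul_le_mul_of_nonneg_left hT hS0
    _ = (c.blocks.prod * S J L) * (N.factorial * 4 ^ (N + c.length)) := by ring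
    _ ≤ (3 ^ i * J.length.factorial) * (N.factorial * 4 ^ (N + c.length)) :=
      mul_le_mul_of_nonneg_right hS (by positivity)
    _ = _ := by ring

theorem abs_N1_le (i : ℕ) (I J : List ℕ) (hI : ∀ x ∈ I, 1 ≤ x) (hJ : ∀ x ∈ J, 1 ≤ x)
    (hI0 : I ≠ []) (hJ0 : J ≠ []) :
    |N1 i I J| ≤ 6 ^ i * (8 ^ I.length * I.length.factorial) *
      (8 ^ J.length * J.length.factorial) := by
  have hI1 : 1 ≤ I.length := List.length_pos_iff.2 hI0
  have hJ1 : 1 ≤ J.length := List.length_pos_iff.2 hJ0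
  have hone : ∀ k : ℕ, (1 : ℚ) ≤ 8 ^ k * k.factorial := fun k =>
    one_le_mul_of_one_le_of_one_le (one_le_pow₀ (by norm_num))
      (by exact_mod_cast k.factorial_pos)
  have hsmall : ∀ k ≤ i, |((i - 1).factorial : ℚ) / ((i + 1 - k).factorial : ℚ)| ≤
      6 ^ i * (8 ^ k * k.factorial) := by
    intro k hk
    rw [abs_of_nonneg (by positivity)]
    refine (factorial_div_le hk).trans ?_
    refine mul_le_mul (pow_le_pow_left₀ (by norm_num) (by norm_num) _) ?_ (by positivity)
      (by positivity)
    exact le_mul_of_one_le_left (by positivity) (one_le_pow₀ (by norm_num))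
  rw [N1]
  split_ifs with h1 h2 h3
  · rw [abs_zero]; positivity
  · rw [not_or, not_not, not_not] at h1
    refine (hsmall _ (h1.2 ▸ length_le_sum J hJ)).trans ?_
    refine mul_le_mul_of_nonneg_right ?_ (by positivity)
    exact le_mul_of_one_le_right (by positivity) (hone _)
  · rw [not_or, not_not, not_not] at h1
    refine (hsmall _ (h1.1 ▸ length_le_sum I hI)).trans ?_
    exact le_mul_of_one_le_right (by positivity) (hone _)
  · obtain ⟨N, hN⟩ : ∃ N, I.length = N + 2 := ⟨I.length - 2, by omega⟩
    rw [hN]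
    calc _ ≤ ∑ _c : Composition i,
          (3 ^ i * (8 ^ (N + J.length) * (J.length.factorial * N.factorial)) : ℚ) := by
          refine (Finset.abs_sum_le_sum_abs _ _).trans (Finset.sum_le_sum fun c _ => ?_)
          rw [show c.length + (N + 2) - 2 = c.length + N by omega]
          by_cases hc : c.length ≤ J.length
          · calc _ ≤ ∑ _d : Composition (c.length + N),
                  (3 ^ i * 4 ^ (N + c.length) * (J.length.factorial * N.factorial) : ℚ) := by
                  refine (Finset.abs_sum_le_sum_abs _ _).trans (Finset.sum_le_sum fun d _ => ?_)
                  split_ifs with h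
                  · exact abs_S_mul_T2_le hJ hN c d h
                  · rw [abs_zero]; positivity
              _ = 3 ^ i * (2 ^ (c.length + N - 1) * 4 ^ (N + c.length) *
                    (J.length.factorial * N.factorial)) := by
                  rw [Finset.sum_const, Finset.card_univ, composition_card, nsmul_eq_mul]
                  push_cast; ring
              _ ≤ _ := by
                  refine mul_le_mul_of_nonneg_left (mul_le_mul_of_nonneg_right ?_
                    (by positivity)) (by positivity)
                  -- The base 8 is 2 · 4: the number of compositions d times the exponential factor
                  -- of T².
                  calc (2 : ℚ) ^ (c.length + N - 1) * 4 ^ (N + c.length) ≤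
                        2 ^ (N + c.length) * 4 ^ (N + c.length) :=
                        mul_le_mul_of_nonneg_right
                          (pow_le_pow_right₀ (by norm_num) (by omega)) (by positivity)
                    _ = 8 ^ (N + c.length) := by rw [← mul_pow]; norm_num
                    _ ≤ _ := pow_le_pow_right₀ (by norm_num) (by omega)
          · rw [Finset.sum_eq_zero, abs_zero]
            · positivity
            intro d _
            split_ifs with h
            · have hlen : c.blocks.length = d.blocks.length := h.symm
              have hfst := List.map_fst_zip hlen.le
              rw [S_eq_zero_of_length_lt, mul_zero, zero_mul]
              · exact fun x hx => c.one_le_blocks (hfst ▸ List.mem_map_of_mem hx)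
              · rw [← List.length_map (f := Prod.fst), hfst, Composition.blocks_length]
                omega
            · rfl
      _ = 2 ^ (i - 1) * 3 ^ i * (8 ^ (N + J.length) * (J.length.factorial * N.factorial)) := by
          rw [Finset.sum_const, Finset.card_univ, composition_card, nsmul_eq_mul]
          push_cast; ring
      _ ≤ 6 ^ i * (8 ^ (N + 2 + J.length) * (J.length.factorial * (N + 2).factorial)) := by
          refine mul_le_mul ?_ ?_ (by positivity) (by positivity)
          · rw [show (6 : ℚ) = 2 * 3 by norm_num, mul_pow]
            exact mul_le_mul_of_nonneg_right (pow_le_pow_right₀ (by norm_num) (by omega))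
              (by positivity)
          · refine mul_le_mul (pow_le_pow_right₀ (by norm_num) (by omega)) ?_ (by positivity)
              (by positivity)
            refine mul_le_mul_of_nonneg_left ?_ (by positivity)
            exact_mod_cast Nat.factorial_le (by omega)
      _ = _ := by ring

/-! ### Summability of multinomial weights. -/

/-- The exponential weight of a system of exponents, normalised by the factorial of its degree. -/
noncomputable def weight {ι : Type*} (y : ι → ℝ) (ν : ι →₀ ℕ) : ℝ :=
  ((ν.sum fun _ n => n).factorial : ℝ) * ν.prod fun i n => y i ^ n / (n.factorial : ℝ)

theorem weight_nonneg {ι : Type*} {y : ι → ℝ} (hy : ∀ i, 0 ≤ y i) (ν : ι →₀ ℕ) :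
    0 ≤ weight y ν :=
  mul_nonneg (Nat.cast_nonneg _) (Finset.prod_nonneg fun i _ =>
    div_nonneg (pow_nonneg (hy i) _) (Nat.cast_nonneg _))

/-- In degree k the weight is a multinomial coefficient times a monomial, so this is the multinomial
theorem. -/
theorem sum_finsuppAntidiag_weight_le {ι : Type*} [DecidableEq ι] (s : Finset ι) {y : ι → ℝ}
    (hy : ∀ i, 0 ≤ y i) (k : ℕ) :
    ∑ ν ∈ s.finsuppAntidiag k, weight y ν ≤ (∑ i ∈ s, y i) ^ k := by
  classical
  rw [Finset.sum_pow_eq_sum_piAntidiag]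
  calc ∑ ν ∈ s.finsuppAntidiag k, weight y ν
      = ∑ f ∈ (s.finsuppAntidiag k).image (fun (ν : ι →₀ ℕ) (i : ι) => ν i),
          (Nat.multinomial s f * ∏ i ∈ s, y i ^ f i : ℝ) := by
        rw [Finset.sum_image fun _ _ _ _ h => DFunLike.coe_injective h]
        refine Finset.sum_congr rfl fun ν hν => ?_
        rw [Finset.mem_finsuppAntidiag] at hν
        rw [weight, Finsupp.sum_of_support_subset ν hν.2 _ (by simp),
          Finsupp.prod_of_support_subset ν hν.2 _ (by simp), ← Nat.multinomial_spec,
          Finset.prod_div_distrib]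
        have : (∏ i ∈ s, ((ν i).factorial : ℝ)) ≠ 0 :=
          Finset.prod_ne_zero_iff.2 fun i _ => by positivity
        push_cast
        field_simp
    _ ≤ _ := by
        refine Finset.sum_le_sum_of_subset_of_nonneg ?_ fun f _ _ =>
          mul_nonneg (Nat.cast_nonneg _) (Finset.prod_nonneg fun i _ => pow_nonneg (hy i) _)
        intro f hf
        obtain ⟨ν, hν, rfl⟩ := Finset.mem_image.1 hf
        rw [Finset.mem_finsuppAntidiag] at hν
        exact Finset.mem_piAntidiag.2 ⟨hν.1, fun i hi => hν.2 (Finsupp.mem_support_iff.2 hi)⟩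

/-- Sorting a finite family by degree bounds its sum by a geometric series; exponents supported
outside s have weight zero. -/
theorem summable_weight {ι : Type*} (s : Finset ι) {y : ι → ℝ} (hy : ∀ i, 0 ≤ y i)
    (hy0 : ∀ i ∉ s, y i = 0) (hlt : ∑ i ∈ s, y i < 1) : Summable (weight y) := by
  classical
  have hq : 0 ≤ ∑ i ∈ s, y i := Finset.sum_nonneg fun i _ => hy i
  refine summable_of_sum_le (c := (1 - ∑ i ∈ s, y i)⁻¹) (weight_nonneg hy) fun Ω => ?_
  set deg : (ι →₀ ℕ) → ℕ := fun ν => ν.sum fun _ n => n with hdeg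
  obtain ⟨K, hK⟩ : ∃ K, ∀ ν ∈ Ω, deg ν < K :=
    ⟨Ω.sup deg + 1, fun ν hν => Nat.lt_succ_of_le (Finset.le_sup hν)⟩
  rw [← Finset.sum_fiberwise_of_maps_to (t := Finset.range K) (g := deg)
    fun ν hν => Finset.mem_range.2 (hK ν hν)]
  calc _ ≤ ∑ k ∈ Finset.range K, (∑ i ∈ s, y i) ^ k := by
        refine Finset.sum_le_sum fun k _ => ?_
        refine le_trans ?_ (sum_finsuppAntidiag_weight_le s hy k)
        rw [← Finset.sum_filter_of_ne (p := fun ν : ι →₀ ℕ => ν.support ⊆ s)]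
        · refine Finset.sum_le_sum_of_subset_of_nonneg ?_ fun ν _ _ => weight_nonneg hy ν
          intro ν hν
          simp only [Finset.mem_filter] at hν
          rw [Finset.mem_finsuppAntidiag]
          exact ⟨(Finsupp.sum_of_support_subset ν hν.2 (fun _ n => n) fun _ _ => rfl).symm.trans
            hν.1.2, hν.2⟩
        · intro ν _ hne i hi
          by_contra his
          refine hne (mul_eq_zero_of_right _ (Finset.prod_eq_zero hi ?_))
          dsimp only
          rw [hy0 i his, zero_pow (Finsupp.mem_support_iff.1 hi), zero_div]
    _ ≤ ∑' k : ℕ, (∑ i ∈ s, y i) ^ k :=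
        (summable_geometric_of_lt_one hq hlt).sum_le_tsum _ fun k _ => pow_nonneg hq k
    _ = _ := tsum_geometric_of_lt_one hq hlt

/-! ### Comparison of the series with the weights. -/

/-- The body of `expand` elaborates to a trivial map over a list coerced entrywise by a monadic
bind; this restores the plain form. -/
theorem expand_eq (ν : ℕ+ →₀ ℕ) :
    expand ν = ((Finsupp.toMultiset ν).sort (· ≤ ·)).map PNat.val := by
  rw [expand, List.map_id', List.bind_eq_flatMap]
  exact List.flatMap_pure_eq_map PNat.val _

theorem one_le_of_mem_expand {ν : ℕ+ →₀ ℕ} {x : ℕ} (hx : x ∈ expand ν) : 1 ≤ x := by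
  rw [expand_eq] at hx
  obtain ⟨i, -, rfl⟩ := List.mem_map.1 hx
  exact i.pos

theorem length_expand (ν : ℕ+ →₀ ℕ) : (expand ν).length = ν.sum fun _ n => n := by
  rw [expand_eq, List.length_map, Multiset.length_sort, Finsupp.card_toMultiset]
  rfl

theorem sum_expand (ν : ℕ+ →₀ ℕ) : (expand ν).sum = ν.sum fun i n => n * i := by
  rw [expand_eq, ← Multiset.sum_coe, ← Multiset.map_coe, Multiset.sort_eq, Finsupp.toMultiset_map,
    Finsupp.sum_toMultiset, Finsupp.sum_mapDomain_index (by simp) (by simp [add_mul])]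
  rfl

theorem expand_ne_nil {ν : ℕ+ →₀ ℕ} (hν : ν ≠ 0) : expand ν ≠ [] := by
  rw [expand_eq, Ne, List.map_eq_nil_iff, ← List.length_eq_zero_iff, Multiset.length_sort,
    Multiset.card_eq_zero]
  exact fun h => hν (Multiset.toFinsupp.symm.injective (h.trans (map_zero _).symm))


theorem weight_expand (t : ℕ+ → ℂ) (ν : ℕ+ →₀ ℕ) :
    (5 / 2 : ℝ) ^ (expand ν).sum * (8 ^ (expand ν).length * (expand ν).length.factorial) *
      ‖ν.prod fun i n => ((i : ℕ) : ℂ) ^ n / (n.factorial : ℂ)‖ * ‖ν.prod fun i n => t i ^ n‖ =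
    weight (fun i : ℕ+ => 8 * ((i : ℕ) : ℝ) * (5 / 2) ^ (i : ℕ) * ‖t i‖) ν := by
  rw [weight, sum_expand, length_expand]
  simp only [Finsupp.sum, Finsupp.prod, norm_prod]
  rw [← Finset.prod_pow_eq_pow_sum, ← Finset.prod_pow_eq_pow_sum]
  have : ∀ i ∈ ν.support, (8 * ((i : ℕ) : ℝ) * (5 / 2) ^ (i : ℕ) * ‖t i‖) ^ ν i /
      ((ν i).factorial : ℝ) = (5 / 2) ^ (ν i * (i : ℕ)) * 8 ^ ν i *
        ‖((i : ℕ) : ℂ) ^ ν i / ((ν i).factorial : ℂ)‖ * ‖t i ^ ν i‖ := by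
    intro i _
    rw [norm_div, norm_pow, norm_pow, Complex.norm_natCast, Complex.norm_natCast, mul_pow, mul_pow,
      mul_pow, mul_comm (ν i), pow_mul]
    ring
  rw [Finset.prod_congr rfl this, Finset.prod_mul_distrib, Finset.prod_mul_distrib,
    Finset.prod_mul_distrib]
  ring

theorem term_eq_zero {t₀ : ℝ} {t u : ℕ+ → ℂ} {x : Index} (h : x.i ≠ (expand x.ν).sum) :
    term t₀ t u x = 0 := by
  have : N2 x.i x.ν x.μ = 0 := by rw [N2, N1, if_pos (Or.inl h)]
  simp [term, this]

theorem norm_N2_le (x : Index) :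
    ‖(N2 x.i x.ν x.μ : ℂ)‖ ≤
      (5 / 2) ^ (expand x.ν).sum * (8 ^ (expand x.ν).length * (expand x.ν).length.factorial) *
      ((5 / 2) ^ (expand x.μ).sum * (8 ^ (expand x.μ).length * (expand x.μ).length.factorial)) := by
  rw [Complex.norm_ratCast]
  by_cases h : x.i ≠ (expand x.ν).sum ∨ x.i ≠ (expand x.μ).sum
  · rw [N2, N1, if_pos h, Rat.cast_zero, abs_zero]; positivity
  rw [not_or, not_not, not_not] at h
  have h1 := abs_N1_le x.i (expand x.ν) (expand x.μ) (fun _ => one_le_of_mem_expand)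
    (fun _ => one_le_of_mem_expand) (expand_ne_nil x.ν_ne) (expand_ne_nil x.μ_ne)
  have h2 : |(N2 x.i x.ν x.μ : ℝ)| ≤
      6 ^ x.i * (8 ^ (expand x.ν).length * (expand x.ν).length.factorial) *
      (8 ^ (expand x.μ).length * (expand x.μ).length.factorial) := by
    exact_mod_cast h1
  refine h2.trans ?_
  rw [← h.1, ← h.2]
  -- Here 6 ≤ (5/2)² = 6.25; each factor goes to one of the two systems of exponents.
  calc _ ≤ ((5 / 2) ^ x.i * (5 / 2) ^ x.i) *
        (8 ^ (expand x.ν).length * (expand x.ν).length.factorial : ℝ) *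
        (8 ^ (expand x.μ).length * (expand x.μ).length.factorial) := by
        refine mul_le_mul_of_nonneg_right (mul_le_mul_of_nonneg_right ?_ (by positivity))
          (by positivity)
        rw [← mul_pow]
        exact pow_le_pow_left₀ (by norm_num) (by norm_num) _
    _ = _ := by ring

theorem norm_term_le {t₀ : ℝ} (h0 : 0 ≤ t₀) (h1 : t₀ ≤ 1) (t u : ℕ+ → ℂ) (x : Index) :
    ‖term t₀ t u x‖ ≤
      weight (fun i : ℕ+ => 8 * ((i : ℕ) : ℝ) * (5 / 2) ^ (i : ℕ) * ‖t i‖) x.ν *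
      weight (fun i : ℕ+ => 8 * ((i : ℕ) : ℝ) * (5 / 2) ^ (i : ℕ) * ‖u i‖) x.μ := by
  rw [← weight_expand, ← weight_expand, term]
  simp only [norm_mul]
  have ht : ‖(t₀ : ℂ) ^ (x.i + 2 - ((x.ν.sum fun _ n => n) + (x.μ.sum fun _ n => n)))‖ ≤ 1 := by
    rw [norm_pow, Complex.norm_real, Real.norm_of_nonneg h0]
    exact pow_le_one₀ h0 h1
  set w := ‖(t₀ : ℂ) ^ (x.i + 2 - ((x.ν.sum fun _ n => n) + (x.μ.sum fun _ n => n)))‖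
  set a := ‖x.ν.prod fun i n => ((i : ℕ) : ℂ) ^ n / (n.factorial : ℂ)‖
  set b := ‖x.μ.prod fun i n => ((i : ℕ) : ℂ) ^ n / (n.factorial : ℂ)‖
  set c := ‖x.ν.prod fun i n => t i ^ n‖
  set d := ‖x.μ.prod fun i n => u i ^ n‖
  have hN := norm_N2_le x
  calc _ = a * b * c * d * (‖(N2 x.i x.ν x.μ : ℂ)‖ * w) := by ring
    _ ≤ a * b * c * d * (_ * 1) :=
      mul_le_mul_of_nonneg_left (mul_le_mul hN ht (norm_nonneg _) (by positivity)) (by positivity)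
    _ = _ := by ring

theorem summable_weight_of_norm_le {n : ℕ} (hn : 1 ≤ n) {t : ℕ+ → ℂ}
    (ht : ∀ i : ℕ+, n < (i : ℕ) → t i = 0)
    (htn : ∀ i : ℕ+, ‖t i‖ ≤ (4 * (n : ℝ) ^ 3 * 2 ^ n * Real.exp 1 ^ n)⁻¹) :
    Summable (weight fun i : ℕ+ => 8 * ((i : ℕ) : ℝ) * (5 / 2) ^ (i : ℕ) * ‖t i‖) := by
  have hn0 : (1 : ℝ) ≤ n := by exact_mod_cast hn
  refine summable_weight (Finset.Icc 1 (n.toPNat hn)) (fun i => by positivity) (fun i hi => ?_) ?_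
  · rw [ht i, norm_zero, mul_zero]
    rw [Finset.mem_Icc, not_and] at hi
    have := hi one_le
    rwa [not_le, ← PNat.coe_lt_coe] at this
  set ε := (4 * (n : ℝ) ^ 3 * 2 ^ n * Real.exp 1 ^ n)⁻¹ with hε
  calc _ ≤ ∑ _i ∈ Finset.Icc (1 : ℕ+) (n.toPNat hn), 8 * (n : ℝ) * (5 / 2) ^ n * ε := by
        refine Finset.sum_le_sum fun i hi => ?_
        have hin : (i : ℕ) ≤ n := (Finset.mem_Icc.1 hi).2
        have hin' : ((i : ℕ) : ℝ) ≤ n := by exact_mod_cast hin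
        refine mul_le_mul (mul_le_mul (by linarith) (pow_le_pow_right₀ (by norm_num) hin)
          (by positivity) (by positivity)) (htn i) (norm_nonneg _) (by positivity)
    _ = n * (8 * (n : ℝ) * (5 / 2) ^ n * ε) := by
        rw [Finset.sum_const, nsmul_eq_mul, PNat.card_Icc, PNat.one_coe, Nat.add_sub_cancel, Nat.toPNat, PNat.mk_coe]
    _ < 1 := by
        -- This makes the final inequality strict; the constant 8 is covered by 4 · n 2^n.
        have he : (5 / 2 : ℝ) < Real.exp 1 := by linarith [Real.exp_one_gt_d9]
        rw [hε, ← div_eq_mul_inv, mul_div_assoc', div_lt_one (by positivity)]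
        have h1 : (5 / 2 : ℝ) ^ n < Real.exp 1 ^ n :=
          pow_lt_pow_left₀ he (by norm_num) (by omega)
        have h2 : (2 : ℝ) ≤ n * 2 ^ n := by
          calc (2 : ℝ) = 1 * 2 ^ 1 := by norm_num
            _ ≤ n * 2 ^ n := mul_le_mul hn0 (pow_le_pow_right₀ (by norm_num) hn) (by norm_num)
                (by positivity)
        calc (n : ℝ) * (8 * n * (5 / 2) ^ n) = 4 * n ^ 2 * 2 * (5 / 2) ^ n := by ring
          _ < 4 * n ^ 2 * 2 * Real.exp 1 ^ n := by gcongr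
          _ ≤ 4 * n ^ 2 * (n * 2 ^ n) * Real.exp 1 ^ n := by gcongr
          _ = _ := by ring

end TodaString

theorem theorem3 (n : ℕ) (hn : 1 ≤ n) (t₀ : ℝ) (t u : ℕ+ → ℂ)
    (ht₀ : 0 < t₀) (ht₀' : t₀ < 1)
    (ht : ∀ i : ℕ+, n < (i : ℕ) → t i = 0)
    (hu : ∀ i : ℕ+, n < (i : ℕ) → u i = 0)
    (htn : ∀ i : ℕ+, ‖t i‖ ≤ (4 * (n : ℝ) ^ 3 * 2 ^ n * Real.exp 1 ^ n)⁻¹)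
    (hun : ∀ i : ℕ+, ‖u i‖ ≤ (4 * (n : ℝ) ^ 3 * 2 ^ n * Real.exp 1 ^ n)⁻¹) :
    Summable (TodaString.series t₀ t u) := by
  classical
  have hterm : Summable (TodaString.term t₀ t u) := by
    -- Nonzero terms have i equal to the weighted degree of ν, so on them the pair (ν, μ) determines
    -- the index.
    rw [← Function.Injective.summable_iff (Subtype.val_injective
      (p := fun x : TodaString.Index => x.i = (TodaString.expand x.ν).sum)) fun x hx =>
        TodaString.term_eq_zero (by simpa using hx)]
    have hinj : Function.Injective fun x : {x : TodaString.Index //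
        x.i = (TodaString.expand x.ν).sum} => (x.1.ν, x.1.μ) := by
      rintro ⟨⟨i, ν, μ, _, _, _⟩, h⟩ ⟨⟨i', ν', μ', _, _, _⟩, h'⟩ heq
      obtain ⟨rfl, rfl⟩ := Prod.mk.inj heq
      obtain rfl : i = i' := h.trans h'.symm
      rfl
    refine Summable.of_norm_bounded (((TodaString.summable_weight_of_norm_le hn ht htn).mul_of_nonneg
      (TodaString.summable_weight_of_norm_le hn hu hun)
      (TodaString.weight_nonneg fun i => by positivity)
      (TodaString.weight_nonneg fun i => by positivity)).comp_injective hinj) fun x => ?_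
    exact TodaString.norm_term_le ht₀.le ht₀'.le t u x.1
  have hzero : Summable (Function.update (TodaString.series t₀ t u) none 0) := by
    rw [← (Option.some_injective TodaString.Index).summable_iff]
    · refine hterm.congr fun x => ?_
      simp [TodaString.series]
    · rintro (_ | x) hx
      · simp
      · exact absurd ⟨x, rfl⟩ hx
  simpa using hzero.update none (TodaString.series t₀ t u none)
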